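/- Let $M\ge 0$, $N\ge 1$. Let $\mathcal X=\mathcal X^{(1)}\times\dots\times\mathcal X^{(M)}$ be the input space ($M$ data sources), $\mathcal Z$ a latent space, $\mathcal Y$ a (standard Borel) target space and $\mathcal W$ a space of model parameters, all measurable. Let $h_1,\dots,h_M:\mathcal X\to\mathcal Z$ and $g:\mathcal Z\to\mathcal Y$ be measurable, $\hat h_i=g\circ h_i$, $\hat h=(\hat h_1,\dots,\hat h_M)$, and $f(x,y)=(\hat h(x),y)$. Let $S=(D_1,\dots,D_N)$, $D_j=(X_j,Y_j)$, be i.i.d. copies of a random pair $(X,Y)$ in $\mathcal X\times\mathcal Y$, let $S_x=(X_1,\dots,X_N)$ and $\hat h(S_x)=(\hat h(X_1),\dots,\hat h(X_N))$, and let $W\in\mathcal W$ be the output of a randomized learning algorithm given by a Markov kernel $P_{W|S}$. Let the loss $\ell$ be a measurable function of $(f(x,y),w)$ with values in $[a,b]$. Put $$L_{f(S)}(w)=\frac1N\sum_{j=1}^N \ell(f(D_j),w),\qquad \bar L(w)=\mathbf E_S[L_{f(S)}(w)],\qquad \mathrm{gap}=\bigl|\mathbf E_{(S,W)}[\bar L(W)-L_{f(S)}(W)]\bigr|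 .$$ All information quantities use natural logarithms and take values in $[0,\infty]$: $I(U;V)$ is the mutual information $D_{\mathrm{KL}}(P_{U,V}\,\|\,P_U\otimes P_V)$; $I(U_1,\dots,U_M)=D_{\mathrm{KL}}(P_{U_1,\dots,U_M}\,\|\,P_{U_1}\otimes\dots\otimes P_{U_M})$; $I(U_1,\dots,U_M\mid V)$ is the average over the law of $V$ of the same quantity for the conditional law of $(U_1,\dots,U_M)$ given $V=v$; and $H(V)=\mathbf E[-\log p(V)]$, $p(v)=P(V=v)$, is the Shannon entropy, which is infinite if the law of $V$ is not purely atomic. Set $$I_1=I(\hat h_1(X),\dots,\hat h_M(X)),\quad I_2=I(\hat h_1(X),\dots,\hat h_M(X)\mid Y),\quad I_3=\sum_{i=1}^M I(\hat h_i(X);Y),\quad I_4=\frac{I(W;\hat h(S_x))}{N},$$ and assume that the subtracted quantities $I_2$ and $I_3$ are finite, so that the expression $I_1-I_2-I_3+H(Y)+I_4$ is meaningful in $(-\infty,\infty]$. Then, with $\sigma=(b-a)/2$, this expression is nonnegative and $$\mathrm{gap}\;\le\;\sqrt{2\sigma^2}\,\sqrt{\,I_1-I_2-I_3+H(Y)+I_4\,}$$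 (where $0\cdot\infty=0$ if $\sigma=0$ and the radicand is infinite). -/

import Mathlib

open MeasureTheory ProbabilityTheory InformationTheory
open scoped ENNReal

namespace FusionBound

noncomputable section

/-! Information measures (natural logarithms, values in `[0, ∞]`). -/

/-- Mutual information `I(U;V)` of two random variables on `(Ω, P)`: the Kullback-Leibler divergence
of the joint law from the product of the two marginal laws. -/
def mutualInfo {Ω α β : Type*} [MeasurableSpace Ω] [MeasurableSpace α] [MeasurableSpace β]
    (P : Measure Ω) (U : Ω → α) (V : Ω → β) : ℝ≥0∞ :=
  klDiv (P.map fun ω => (U ω, V ω)) ((P.map U).prod (P.map V))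

/-- Multivariate mutual information of the coordinates of a law `ν` on `α^M`: the Kullback-Leibler
divergence of `ν` from the product of its one-dimensional marginals. -/
def multiInfoLaw {M : ℕ} {α : Type*} [MeasurableSpace α] (ν : Measure (Fin M → α)) : ℝ≥0∞ :=
  klDiv ν (Measure.pi fun i => ν.map fun u => u i)

/-- `I(U_1, …, U_M) = E log (P(U_1, …, U_M) / (P(U_1) ⋯ P(U_M)))`. -/
def multiInfo {Ω α : Type*} [MeasurableSpace Ω] [MeasurableSpace α] {M : ℕ}
    (P : Measure Ω) (U : Ω → Fin M → α) : ℝ≥0∞ :=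
  multiInfoLaw (P.map U)

/-- `I(U_1, …, U_M | V) = E log (P(U_1, …, U_M | V) / (P(U_1 | V) ⋯ P(U_M | V)))`: the multivariate
mutual information of the regular conditional law of `(U_1, …, U_M)` given `V = v`, averaged over
the law of `V`. -/
def condMultiInfo {Ω α β : Type*} [MeasurableSpace Ω] [MeasurableSpace α] [StandardBorelSpace α]
    [Nonempty α] [MeasurableSpace β] {M : ℕ}
    (P : Measure Ω) [IsFiniteMeasure P] (U : Ω → Fin M → α) (V : Ω → β) : ℝ≥0∞ :=
  ∫⁻ v, multiInfoLaw (condDistrib U V P v) ∂(P.map V)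

/-- Shannon entropy `H(V) = E[-log p(V)]` with `p(v) = P(V = v)` and `-log 0 = ∞`. For a discrete
`V` this is `∑ v, p(v) log (1 / p(v))`; it is `∞` if the law of `V` is not purely atomic. -/
def entropy {Ω β : Type*} [MeasurableSpace Ω] [MeasurableSpace β]
    (P : Measure Ω) (V : Ω → β) : ℝ≥0∞ :=
  ∫⁻ v, (-ENNReal.log (P.map V {v})).toENNReal ∂(P.map V)

/-! The learning problem. -/

/-- `ĥ = (ĥ_1, …, ĥ_M)` with `ĥ_i = g ∘ h_i`. -/
def hHat {M : ℕ} {X Z Y : Type*} (g : Z → Y) (h : Fin M → X → Z) (x : X) : Fin M → Y :=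
  fun i => g (h i x)

/-- `f(D) = (ĥ(X), Y)` for a sample point `D = (X, Y)`. -/
def feat {M : ℕ} {X Z Y : Type*} (g : Z → Y) (h : Fin M → X → Z) (d : X × Y) : (Fin M → Y) × Y :=
  (hHat g h d.1, d.2)

/-- Empirical risk `L_{f(S)}(w) = (1/N) ∑_j ℓ(f(D_j), w)`. -/
def empRisk {M N : ℕ} {X Z Y W : Type*} (g : Z → Y) (h : Fin M → X → Z)
    (ℓ : (Fin M → Y) × Y → W → ℝ) (s : Fin N → X × Y) (w : W) : ℝ :=
  (1 / (N : ℝ)) * ∑ j, ℓ (feat g h (s j)) w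

/-- The law `P_S` of `N` independent sample points with law `μ`. -/
def sampleLaw {D : Type*} [MeasurableSpace D] (N : ℕ) (μ : Measure D) : Measure (Fin N → D) :=
  Measure.pi fun _ => μ

/-- Population risk of `w`: the expected empirical risk of `w` on a sample with law `P_S`. -/
def popRisk {M : ℕ} {X Z Y W : Type*} [MeasurableSpace X] [MeasurableSpace Y] (N : ℕ)
    (μ : Measure (X × Y)) (g : Z → Y) (h : Fin M → X → Z)
    (ℓ : (Fin M → Y) × Y → W → ℝ) (w : W) : ℝ :=
  ∫ s, empRisk g h ℓ s w ∂(sampleLaw N μ)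

/-- The joint law of `(S, W)`: `S` has law `P_S`, and `κ = P_{W|S}` is the learning algorithm. -/
def jointLaw {D W : Type*} [MeasurableSpace D] [MeasurableSpace W] {N : ℕ}
    (μ : Measure D) (κ : Kernel (Fin N → D) W) : Measure ((Fin N → D) × W) :=
  (sampleLaw N μ).compProd κ

/-- The expected generalization gap `g(P_S, P_{W|S})`: the absolute value of the expected difference
between population risk and empirical risk under the joint law of `(S, W)`. -/
def genGap {M N : ℕ} {X Z Y W : Type*} [MeasurableSpace X] [MeasurableSpace Y] [MeasurableSpace W]
    (μ : Measure (X × Y)) (κ : Kernel (Fin N → X × Y) W) (g : Z → Y) (h : Fin M → X → Z)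
    (ℓ : (Fin M → Y) × Y → W → ℝ) : ℝ :=
  |∫ p, (popRisk N μ g h ℓ p.2 - empRisk g h ℓ p.1 p.2) ∂(jointLaw μ κ)|

/-- `I₁ = I(ĥ_1(X), …, ĥ_M(X))`. -/
def I₁ {M : ℕ} {X Z Y : Type*} [MeasurableSpace X] [MeasurableSpace Y]
    (μ : Measure (X × Y)) (g : Z → Y) (h : Fin M → X → Z) : ℝ≥0∞ :=
  multiInfo μ fun d => hHat g h d.1

/-- `I₂ = I(ĥ_1(X), …, ĥ_M(X) | Y)`. -/
def I₂ {M : ℕ} {X Z Y : Type*} [MeasurableSpace X] [MeasurableSpace Y] [StandardBorelSpace Y]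
    [Nonempty Y] (μ : Measure (X × Y)) [IsFiniteMeasure μ]
    (g : Z → Y) (h : Fin M → X → Z) : ℝ≥0∞ :=
  condMultiInfo μ (fun d => hHat g h d.1) (fun d => d.2)

/-- `I₃ = ∑ i, I(ĥ_i(X); Y)`, the sum over the `M` base learners. -/
def I₃ {M : ℕ} {X Z Y : Type*} [MeasurableSpace X] [MeasurableSpace Y]
    (μ : Measure (X × Y)) (g : Z → Y) (h : Fin M → X → Z) : ℝ≥0∞ :=
  ∑ i, mutualInfo μ (fun d => hHat g h d.1 i) (fun d => d.2)

/-- `I₄ = I(W; ĥ(S_x)) / N`, where `ĥ(S_x) = (ĥ(X_1), …, ĥ(X_N))`. -/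
def I₄ {M N : ℕ} {X Z Y W : Type*} [MeasurableSpace X] [MeasurableSpace Y] [MeasurableSpace W]
    (μ : Measure (X × Y)) (κ : Kernel (Fin N → X × Y) W)
    (g : Z → Y) (h : Fin M → X → Z) : ℝ≥0∞ :=
  mutualInfo (jointLaw μ κ) (fun p => p.2) (fun p j => hHat g h (p.1 j).1) / (N : ℝ≥0∞)

/-- The radicand `I₁ - I₂ - I₃ + H(Y) + I₄`, in the extended reals (no `∞ - ∞` occurs when `I₂` and
`I₃` are finite). -/
def radicand {M N : ℕ} {X Z Y W : Type*} [MeasurableSpace X] [MeasurableSpace Y]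
    [StandardBorelSpace Y] [Nonempty Y] [MeasurableSpace W]
    (μ : Measure (X × Y)) [IsFiniteMeasure μ] (κ : Kernel (Fin N → X × Y) W)
    (g : Z → Y) (h : Fin M → X → Z) : EReal :=
  (I₁ μ g h : EReal) - (I₂ μ g h : EReal) - (I₃ μ g h : EReal)
    + (entropy μ (fun d => d.2) : EReal) + (I₄ μ κ g h : EReal)

end

end FusionBound

-- Write J for the mutual information of ĥ(X) and Y. Comparing the law of (ĥ(X), Y) with the product
-- of all its one-dimensional marginals in two orders gives I₁ + J = I₂ + I₃
-- (`multiInfo_add_mutualInfo`), so the radicand is H(Y) - J + I₄. What remains is an information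
-- bound in which W is compared with ĥ(S_x) only, each label costing H(Y) - J, the conditional
-- entropy of Y given ĥ(X) when Y is discrete.
--
-- The bound is a change of measure from the joint law of (W, f(S)) to the product of its marginals,
-- under which Hoeffding's lemma controls the exponential moment of the risk difference. The change
-- is made in three moves. Labels are decoupled from (W, ĥ(S_x)) at the price of the factor 1/p(Y_1)
-- ⋯ 1/p(Y_N), because a joint law restricted to one atom of the labels is at most its first
-- marginal (`lintegral_mul_measure_singleton_le`). Then W is decoupled from ĥ(S_x) through a
-- Radon-Nikodym derivative. Finally each label is coupled back to its own ĥ(X_j), through the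
-- density whose expected logarithm is J. Taking logarithms inside the expectation by Jensen
-- (`integral_le_of_lintegral_exp_le`) yields, for every real t, t · gap ≤ σ²t²/2 + radicand for the
-- signed gap (`mul_gap_le`). The choice t = 0 gives nonnegativity and optimizing t gives the square
-- root.

namespace FusionBound

-- Densities of product measures.

section PiDensity

variable {ι : Type*} [Fintype ι] {α : ι → Type*} [∀ i, MeasurableSpace (α i)]

theorem lintegral_prod_pi (μ : ∀ i, Measure (α i)) [∀ i, IsProbabilityMeasure (μ i)]
    {f : ∀ i, α i → ℝ≥0∞} (hf : ∀ i, Measurable (f i)) :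
    ∫⁻ x, ∏ i, f i (x i) ∂(Measure.pi μ) = ∏ i, ∫⁻ x, f i x ∂(μ i) := by
  have h := lintegral_prod_eq_prod_lintegral_of_indepFun (μ := Measure.pi μ) Finset.univ
    (fun i x => f i (x i)) (iIndepFun_pi fun i => (hf i).aemeasurable)
    (fun i => (hf i).comp (measurable_pi_apply i))
  rw [h]
  exact Finset.prod_congr rfl fun i _ =>
    (measurePreserving_eval μ i).lintegral_comp (hf i)

theorem pi_withDensity (μ : ∀ i, Measure (α i)) [∀ i, IsProbabilityMeasure (μ i)]
    {f : ∀ i, α i → ℝ≥0∞} (hf : ∀ i, Measurable (f i))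
    [∀ i, SigmaFinite ((μ i).withDensity (f i))] :
    Measure.pi (fun i => (μ i).withDensity (f i)) =
      (Measure.pi μ).withDensity fun x => ∏ i, f i (x i) := by
  refine Measure.pi_eq fun s hs => ?_
  rw [withDensity_apply _ (MeasurableSet.univ_pi hs),
    ← lintegral_indicator (MeasurableSet.univ_pi hs)]
  have : (Set.univ.pi s).indicator (fun x : ∀ i, α i => ∏ i, f i (x i)) =
      fun x => ∏ i, (s i).indicator (f i) (x i) := by
    funext x
    by_cases hx : x ∈ Set.univ.pi s
    · rw [Set.indicator_of_mem hx]
      exact Finset.prod_congr rfl fun i _ =>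
        (Set.indicator_of_mem (hx i (Set.mem_univ i)) _).symm
    · rw [Set.indicator_of_notMem hx]
      simp only [Set.mem_pi, Set.mem_univ, true_imp_iff, not_forall] at hx
      obtain ⟨i, hi⟩ := hx
      exact (Finset.prod_eq_zero (Finset.mem_univ i) (Set.indicator_of_notMem hi _)).symm
  rw [this, lintegral_prod_pi μ fun i => (hf i).indicator (hs i)]
  exact Finset.prod_congr rfl fun i _ => by
    rw [lintegral_indicator (hs i), withDensity_apply _ (hs i)]

end PiDensity

-- Divergence of kernels over a common base measure.

section CondKL

variable {α β : Type*} {mα : MeasurableSpace α} {mβ : MeasurableSpace β}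
  [MeasurableSpace.CountableOrCountablyGenerated α β]

/-- In the form with `klFun` the divergence is an integral of a nonnegative function, so Tonelli
applies without integrability. If absolute continuity fails, it fails on a set of fibres of positive
measure, and both sides are infinite. -/
theorem klDiv_compProd_right_eq_lintegral (m : Measure α) [IsFiniteMeasure m]
    (κ η : Kernel α β) [IsMarkovKernel κ] [IsMarkovKernel η] :
    klDiv (m ⊗ₘ κ) (m ⊗ₘ η) = ∫⁻ a, klDiv (κ a) (η a) ∂m := by
  by_cases hac : m ⊗ₘ κ ≪ m ⊗ₘ η
  · have hae := Measure.absolutelyContinuous_compProd_right_iff.mp hac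
    have hd : m ⊗ₘ κ = (m ⊗ₘ η).withDensity fun p => κ.rnDeriv η p.1 p.2 := by
      rw [← Measure.compProd_withDensity (by fun_prop)]
      refine Measure.compProd_congr ?_
      filter_upwards [hae] with a ha using (Kernel.withDensity_rnDeriv_eq ha).symm
    have hr : (m ⊗ₘ κ).rnDeriv (m ⊗ₘ η) =ᵐ[m ⊗ₘ η] fun p => κ.rnDeriv η p.1 p.2 := by
      conv_lhs => rw [hd]
      exact Measure.rnDeriv_withDensity _ (by fun_prop)
    rw [klDiv_eq_lintegral_klFun_of_ac hac]
    calc ∫⁻ p, ENNReal.ofReal (klFun ((m ⊗ₘ κ).rnDeriv (m ⊗ₘ η) p).toReal) ∂(m ⊗ₘ η)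
        = ∫⁻ p, ENNReal.ofReal (klFun (κ.rnDeriv η p.1 p.2).toReal) ∂(m ⊗ₘ η) := by
          refine lintegral_congr_ae ?_
          filter_upwards [hr] with p hp
          rw [hp]
      _ = ∫⁻ a, ∫⁻ b, ENNReal.ofReal (klFun (κ.rnDeriv η a b).toReal) ∂(η a) ∂m :=
          Measure.lintegral_compProd (by fun_prop)
      _ = ∫⁻ a, klDiv (κ a) (η a) ∂m := by
          refine lintegral_congr_ae ?_
          filter_upwards [hae] with a ha
          rw [klDiv_eq_lintegral_klFun_of_ac ha]
          refine lintegral_congr_ae ?_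
          filter_upwards [Kernel.rnDeriv_eq_rnDeriv_measure (κ := κ) (η := η) (a := a)] with b hb
          rw [hb]
  · rw [klDiv_of_not_ac hac]
    have hs := Kernel.measurableSet_absolutelyContinuous κ η
    have hpos : m {a | κ a ≪ η a}ᶜ ≠ 0 := fun h0 =>
      hac (Measure.absolutelyContinuous_compProd_right_iff.mpr h0)
    symm
    rw [eq_top_iff]
    calc ∞ = ∫⁻ _ in {a | κ a ≪ η a}ᶜ, ∞ ∂m := by
          simp [ENNReal.top_mul hpos]
      _ = ∫⁻ a in {a | κ a ≪ η a}ᶜ, klDiv (κ a) (η a) ∂m :=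
          setLIntegral_congr_fun hs.compl fun a ha => (klDiv_of_not_ac ha).symm
      _ ≤ ∫⁻ a, klDiv (κ a) (η a) ∂m := setLIntegral_le_lintegral _ _

theorem measurable_klDiv_kernel (κ η : Kernel α β) [IsMarkovKernel κ] [IsMarkovKernel η] :
    Measurable fun a => klDiv (κ a) (η a) := by
  classical
  have hs := Kernel.measurableSet_absolutelyContinuous κ η
  have h : (fun a => klDiv (κ a) (η a)) = {a | κ a ≪ η a}.piecewise
      (fun a => ∫⁻ b, ENNReal.ofReal (klFun (κ.rnDeriv η a b).toReal) ∂(η a)) (fun _ => ∞) := by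
    funext a
    by_cases ha : κ a ≪ η a
    · rw [Set.piecewise_eq_of_mem _ _ _ ha, klDiv_eq_lintegral_klFun_of_ac ha]
      refine lintegral_congr_ae ?_
      filter_upwards [Kernel.rnDeriv_eq_rnDeriv_measure (κ := κ) (η := η) (a := a)] with b hb
      rw [hb]
    · rw [Set.piecewise_eq_of_notMem _ _ _ ha, klDiv_of_not_ac ha]
  rw [h]
  refine Measurable.piecewise hs ?_ measurable_const
  exact Measurable.lintegral_kernel_prod_right (by fun_prop)

end CondKL

-- Divergence from a product measure.

section PiKL

variable {M : ℕ} {α : Type*} [MeasurableSpace α]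

/-- The log-density splits through the product of the marginals of `κ`, whose density with respect
to `Measure.pi ν` is a product over coordinates. Infinite values are allowed on both sides, so
finiteness has to be transferred in each direction. -/
theorem klDiv_pi_eq_add (κ : Measure (Fin M → α)) [IsProbabilityMeasure κ]
    (ν : Fin M → Measure α) [∀ i, IsProbabilityMeasure (ν i)] :
    klDiv κ (Measure.pi ν) =
      multiInfoLaw κ + ∑ i, klDiv (κ.map fun u => u i) (ν i) := by
  set c : Fin M → Measure α := fun i => κ.map fun u => u i with hc
  have hcp : ∀ i, IsProbabilityMeasure (c i) := fun i =>
    Measure.isProbabilityMeasure_map (measurable_pi_apply i).aemeasurable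
  change _ = klDiv κ (Measure.pi c) + ∑ i, klDiv (c i) (ν i)
  have hpi : (∀ i, c i ≪ ν i) → Measure.pi c =
      (Measure.pi ν).withDensity fun x => ∏ i, (c i).rnDeriv (ν i) (x i) := by
    intro h
    have e : ∀ i, (ν i).withDensity ((c i).rnDeriv (ν i)) = c i := fun i =>
      Measure.withDensity_rnDeriv_eq _ _ (h i)
    have : ∀ i, SigmaFinite ((ν i).withDensity ((c i).rnDeriv (ν i))) := fun i => by
      rw [e i]; infer_instance
    rw [← pi_withDensity ν fun i => Measure.measurable_rnDeriv _ _]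
    simp_rw [e]
  have hcoord : (∀ i, c i ≪ ν i) → ∀ᵐ x ∂κ, ∀ i,
      0 < (c i).rnDeriv (ν i) (x i) ∧ (c i).rnDeriv (ν i) (x i) < ∞ := by
    intro h
    rw [ae_all_iff]
    intro i
    have h1 : ∀ᵐ v ∂(c i), 0 < (c i).rnDeriv (ν i) v ∧ (c i).rnDeriv (ν i) v < ∞ :=
      (Measure.rnDeriv_pos (h i)).and ((h i).ae_le (Measure.rnDeriv_lt_top _ _))
    exact ae_of_ae_map (measurable_pi_apply i).aemeasurable h1
  have hllr : (∀ i, c i ≪ ν i) → κ ≪ Measure.pi c → κ ≪ Measure.pi ν →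
      llr κ (Measure.pi ν) =ᵐ[κ]
        fun x => llr κ (Measure.pi c) x + ∑ i, llr (c i) (ν i) (x i) := by
    intro h h1 h2
    have hr : (Measure.pi c).rnDeriv (Measure.pi ν) =ᵐ[Measure.pi ν]
        fun x => ∏ i, (c i).rnDeriv (ν i) (x i) := by
      conv_lhs => rw [hpi h]
      exact Measure.rnDeriv_withDensity _ (by fun_prop)
    filter_upwards [hcoord h, h2.ae_le hr, h2.ae_le (Measure.rnDeriv_mul_rnDeriv h1),
      Measure.rnDeriv_pos h1, h1.ae_le (Measure.rnDeriv_lt_top κ (Measure.pi c))]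
      with x hx hx1 hx2 hx3 hx4
    simp only [llr]
    rw [← hx2, Pi.mul_apply, hx1, ENNReal.toReal_mul, ENNReal.toReal_prod,
      Real.log_mul (ENNReal.toReal_pos hx3.ne' hx4.ne).ne', Real.log_prod]
    · exact fun i _ => (ENNReal.toReal_pos (hx i).1.ne' (hx i).2.ne).ne'
    · exact Finset.prod_ne_zero_iff.mpr
        fun i _ => (ENNReal.toReal_pos (hx i).1.ne' (hx i).2.ne).ne'
  have hintc : (∀ i, Integrable (llr (c i) (ν i)) (c i)) →
      ∀ i, Integrable (fun x => llr (c i) (ν i) (x i)) κ := fun h i =>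
    (h i).comp_measurable (measurable_pi_apply i)
  by_cases hfin : klDiv κ (Measure.pi c) ≠ ∞ ∧ ∀ i, klDiv (c i) (ν i) ≠ ∞
  · obtain ⟨h1, h2⟩ := hfin
    have h1' := klDiv_ne_top_iff.mp h1
    have h2' := fun i => klDiv_ne_top_iff.mp (h2 i)
    have hac : κ ≪ Measure.pi ν := by
      refine h1'.1.trans ?_
      rw [hpi fun i => (h2' i).1]
      exact withDensity_absolutelyContinuous _ _
    have hl := hllr (fun i => (h2' i).1) h1'.1 hac
    have hi := hintc fun i => (h2' i).2
    have hint : Integrable (llr κ (Measure.pi ν)) κ :=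
      (integrable_congr hl).mpr (h1'.2.add (integrable_finsetSum _ fun i _ => hi i))
    have hs : ∑ i, klDiv (c i) (ν i) ≠ ∞ := by simp [h2]
    rw [← ENNReal.toReal_eq_toReal_iff' (klDiv_ne_top hac hint) (ENNReal.add_ne_top.mpr ⟨h1, hs⟩),
      ENNReal.toReal_add h1 hs, ENNReal.toReal_sum fun i _ => h2 i,
      toReal_klDiv_of_measure_eq hac (by simp), toReal_klDiv_of_measure_eq h1'.1 (by simp),
      integral_congr_ae hl, integral_add h1'.2 (integrable_finsetSum _ fun i _ => hi i),
      integral_finsetSum _ fun i _ => hi i]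
    congr 1
    refine Finset.sum_congr rfl fun i _ => ?_
    rw [toReal_klDiv_of_measure_eq (h2' i).1 (by simp), hc,
      integral_map (measurable_pi_apply i).aemeasurable (by fun_prop)]
  · have hR : klDiv κ (Measure.pi c) + ∑ i, klDiv (c i) (ν i) = ∞ := by
      by_contra h
      obtain ⟨ha, hb⟩ := ENNReal.add_ne_top.mp h
      exact hfin ⟨ha, fun i => (ENNReal.sum_ne_top.mp hb) i (Finset.mem_univ i)⟩
    rw [hR]
    by_contra hL
    refine hfin ?_
    -- Data processing under the coordinate projections.
    have h2 : ∀ i, klDiv (c i) (ν i) ≠ ∞ := fun i => by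
      have h := klDiv_map_le κ (Measure.pi ν) (measurable_pi_apply i)
      rw [(measurePreserving_eval ν i).map_eq] at h
      exact ne_top_of_le_ne_top hL h
    have h2' := fun i => klDiv_ne_top_iff.mp (h2 i)
    obtain ⟨hac, hint⟩ := klDiv_ne_top_iff.mp hL
    -- The density of `Measure.pi c` is positive `κ`-almost everywhere, so a `Measure.pi c`-null set
    -- meets its support in a `Measure.pi ν`-null set and is `κ`-null.
    have h1 : κ ≪ Measure.pi c := by
      rw [hpi fun i => (h2' i).1]
      intro s hs
      rw [withDensity_apply_eq_zero (by fun_prop)] at hs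
      have h0 := hac hs
      have hpos := hcoord fun i => (h2' i).1
      have : ∀ᵐ x ∂κ, x ∉ s := by
        have h0' : ∀ᵐ x ∂κ, x ∉ {x | ∏ i, (c i).rnDeriv (ν i) (x i) ≠ 0} ∩ s :=
          measure_eq_zero_iff_ae_notMem.mp h0
        filter_upwards [h0', hpos] with x hx hx' hxs
        exact hx ⟨Finset.prod_ne_zero_iff.mpr fun i _ => (hx' i).1.ne', hxs⟩
      exact measure_eq_zero_iff_ae_notMem.mpr this
    have hl := hllr (fun i => (h2' i).1) h1 hac
    refine ⟨klDiv_ne_top h1 ?_, h2⟩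
    have hi := hintc fun i => (h2' i).2
    refine (integrable_congr ?_).mpr (hint.sub (integrable_finsetSum Finset.univ fun i _ => hi i))
    filter_upwards [hl] with x hx
    simp [hx]

end PiKL

-- The chain rule I₁ + J = I₂ + I₃.

section ChainRule

theorem klDiv_map_measurableEquiv {α β : Type*} [MeasurableSpace α] [MeasurableSpace β]
    (μ ν : Measure α) [IsFiniteMeasure μ] [IsFiniteMeasure ν] (e : α ≃ᵐ β) :
    klDiv (μ.map e) (ν.map e) = klDiv μ ν := by
  refine le_antisymm (klDiv_map_le _ _ e.measurable) ?_
  have h := klDiv_map_le (μ.map e) (ν.map e) e.symm.measurable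
  simpa [Measure.map_map e.symm.measurable e.measurable] using h

variable {Ω α β : Type*} [MeasurableSpace Ω] [MeasurableSpace α] [MeasurableSpace β]

theorem klDiv_prod_comm_eq_lintegral [StandardBorelSpace α] [Nonempty α]
    (P : Measure Ω) [IsProbabilityMeasure P] {U : Ω → α} {V : Ω → β}
    (hU : Measurable U) (hV : Measurable V) (ν : Measure α) [IsProbabilityMeasure ν] :
    klDiv (P.map fun ω => (U ω, V ω)) (ν.prod (P.map V)) =
      ∫⁻ v, klDiv (condDistrib U V P v) ν ∂(P.map V) := by
  have hPV := Measure.isProbabilityMeasure_map (μ := P) hV.aemeasurable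
  have hPVU := Measure.isProbabilityMeasure_map (μ := P) (hV.prodMk hU).aemeasurable
  have h := klDiv_compProd_right_eq_lintegral (P.map V) (condDistrib U V P) (Kernel.const β ν)
  rw [compProd_map_condDistrib hU.aemeasurable, Measure.compProd_const,
    ← klDiv_map_measurableEquiv _ _ MeasurableEquiv.prodComm] at h
  change klDiv (Measure.map Prod.swap _) (Measure.map Prod.swap _) = _ at h
  rw [Measure.prod_swap, Measure.map_map measurable_swap (hV.prodMk hU)] at h
  simpa [Function.comp_def] using h

/-- Both sides are the divergence of the law of (U, V) from the product of the laws of all U_i and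
of V. Disintegrating over U gives the left side. Disintegrating over V and applying
`klDiv_pi_eq_add` in each fibre gives the right side. -/
theorem multiInfo_add_mutualInfo {M : ℕ} [StandardBorelSpace α] [Nonempty α]
    [StandardBorelSpace β] [Nonempty β] (P : Measure Ω) [IsProbabilityMeasure P]
    {U : Ω → Fin M → α} {V : Ω → β} (hU : Measurable U) (hV : Measurable V) :
    multiInfo P U + mutualInfo P U V =
      condMultiInfo P U V + ∑ i, mutualInfo P (fun ω => U ω i) V := by
  have hPV := Measure.isProbabilityMeasure_map (μ := P) hV.aemeasurable
  have hPU := Measure.isProbabilityMeasure_map (μ := P) hU.aemeasurable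
  have hUi : ∀ i, Measurable fun ω => U ω i := fun i => (measurable_pi_apply i).comp hU
  have hPUi := fun i => Measure.isProbabilityMeasure_map (μ := P) (hUi i).aemeasurable
  have hmarg : ∀ i, (P.map U).map (fun u => u i) = P.map fun ω => U ω i := fun i =>
    Measure.map_map (measurable_pi_apply i) hU
  have hL : multiInfo P U + mutualInfo P U V =
      klDiv (P.map fun ω => (U ω, V ω))
        ((Measure.pi fun i => P.map fun ω => U ω i).prod (P.map V)) := by
    rw [multiInfo, multiInfoLaw, mutualInfo, ← compProd_map_condDistrib hV.aemeasurable,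
      ← Measure.compProd_const, ← Measure.compProd_const]
    simp_rw [hmarg]
    exact (klDiv_compProd_eq_add _ _ _ _).symm
  rw [hL, klDiv_prod_comm_eq_lintegral P hU hV]
  simp_rw [klDiv_pi_eq_add]
  have hmeas : ∀ i, Measurable fun v =>
      klDiv ((condDistrib U V P v).map fun u => u i) (P.map fun ω => U ω i) := by
    intro i
    have := Kernel.IsMarkovKernel.map (condDistrib U V P) (measurable_pi_apply (X := fun _ => α) i)
    have h := measurable_klDiv_kernel ((condDistrib U V P).map fun u => u i)
      (Kernel.const β (P.map fun ω => U ω i))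
    simpa [Kernel.map_apply _ (measurable_pi_apply (X := fun _ => α) i)] using h
  rw [lintegral_add_right _ (Finset.measurable_sum _ fun i _ => hmeas i),
    lintegral_finsetSum _ fun i _ => hmeas i, condMultiInfo]
  congr 1
  refine Finset.sum_congr rfl fun i _ => ?_
  rw [mutualInfo, klDiv_prod_comm_eq_lintegral P (hUi i) hV]
  refine lintegral_congr_ae ?_
  filter_upwards [condDistrib_comp V hU.aemeasurable (measurable_pi_apply (X := fun _ => α) i)
    (μ := P)] with v hv
  rw [Kernel.map_apply _ (measurable_pi_apply i)] at hv
  rw [← hv]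
  rfl

end ChainRule

-- Decoupling a variable through its atoms.

section Atoms

variable {α β : Type*} [MeasurableSpace α] [MeasurableSpace β]

theorem countable_setOf_measure_singleton_ne_zero [MeasurableSingletonClass β]
    (m : Measure β) [IsFiniteMeasure m] : {y | m {y} ≠ 0}.Countable := by
  have h := Measure.countable_meas_pos_of_disjoint_iUnion (μ := m) (As := fun y : β => {y})
    (fun y => measurableSet_singleton y) (fun x y hxy => by simpa using hxy)
  simpa [pos_iff_ne_zero] using h

theorem measurable_measure_singleton [StandardBorelSpace β] (m : Measure β) [IsFiniteMeasure m] :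
    Measurable fun y => m {y} := by
  have h := measurable_measure_prodMk_left (ν := m) (measurableSet_diagonal (α := β))
  have e : ∀ y : β, Prod.mk y ⁻¹' Set.diagonal β = {y} := fun y => by
    ext z; simp [eq_comm]
  simpa [e] using h

/-- This is the integrated form of the fact that mutual information is at most entropy. The weight
vanishes off the countably many atoms, and over a single atom the first marginal of the restriction
of `ρ` is at most `ρ.fst`. -/
theorem lintegral_mul_measure_singleton_le [StandardBorelSpace β]
    (ρ : Measure (α × β)) [IsFiniteMeasure ρ] {G : α × β → ℝ≥0∞} (hG : Measurable G) :
    ∫⁻ z, G z * ρ.snd {z.2} ∂ρ ≤ ∫⁻ y, ∫⁻ x, G (x, y) ∂ρ.fst ∂ρ.snd := by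
  set A : Set β := {y | ρ.snd {y} ≠ 0} with hA
  have hAc : A.Countable := countable_setOf_measure_singleton_ne_zero _
  calc ∫⁻ z, G z * ρ.snd {z.2} ∂ρ
      = ∫⁻ z in ⋃ a ∈ A, Prod.snd ⁻¹' {a}, G z * ρ.snd {z.2} ∂ρ := by
        rw [← Set.preimage_iUnion₂, Set.biUnion_of_singleton,
          ← lintegral_indicator (measurable_snd hAc.measurableSet), Set.indicator_eq_self.mpr]
        exact fun z hz => right_ne_zero_of_mul hz
    _ ≤ ∑' a : A, ∫⁻ z in Prod.snd ⁻¹' {(a : β)}, G z * ρ.snd {z.2} ∂ρ := by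
        have := hAc.to_subtype
        rw [Set.biUnion_eq_iUnion]
        exact lintegral_iUnion_le _ _
    _ ≤ ∑' a : A, (∫⁻ x, G (x, a) ∂ρ.fst) * ρ.snd {(a : β)} := by
        refine ENNReal.tsum_le_tsum fun a => ?_
        calc ∫⁻ z in Prod.snd ⁻¹' {(a : β)}, G z * ρ.snd {z.2} ∂ρ
            = ∫⁻ z in Prod.snd ⁻¹' {(a : β)}, G (z.1, a) * ρ.snd {(a : β)} ∂ρ := by
              refine setLIntegral_congr_fun (measurable_snd (measurableSet_singleton _)) ?_
              rintro ⟨x, y⟩ hz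
              obtain rfl : y = a := hz
              rfl
          _ ≤ ∫⁻ z, G (z.1, a) * ρ.snd {(a : β)} ∂ρ := setLIntegral_le_lintegral _ _
          _ = (∫⁻ x, G (x, a) ∂ρ.fst) * ρ.snd {(a : β)} := by
              rw [lintegral_mul_const _ (by fun_prop), Measure.fst,
                lintegral_map (by fun_prop) measurable_fst]
    _ = ∫⁻ y in A, ∫⁻ x, G (x, y) ∂ρ.fst ∂ρ.snd :=
        (lintegral_countable (fun y => ∫⁻ x, G (x, y) ∂ρ.fst) hAc).symm
    _ ≤ ∫⁻ y, ∫⁻ x, G (x, y) ∂ρ.fst ∂ρ.snd := setLIntegral_le_lintegral _ _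

end Atoms

-- Jensen's inequality for the exponential.

section Gibbs

variable {Ω : Type*} [MeasurableSpace Ω]

theorem integral_le_of_lintegral_exp_le (P : Measure Ω) [IsProbabilityMeasure P] {Z : Ω → ℝ}
    (hZ : Integrable Z P) {C : ℝ}
    (h : ∫⁻ ω, ENNReal.ofReal (Real.exp (Z ω)) ∂P ≤ ENNReal.ofReal (Real.exp C)) :
    ∫ ω, Z ω ∂P ≤ C := by
  have hm : AEStronglyMeasurable (fun ω => Real.exp (Z ω)) P :=
    Real.continuous_exp.comp_aestronglyMeasurable hZ.1
  have hint : Integrable (fun ω => Real.exp (Z ω)) P := by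
    refine ⟨hm, ?_⟩
    rw [hasFiniteIntegral_iff_ofReal (ae_of_all _ fun ω => (Real.exp_pos _).le)]
    exact h.trans_lt ENNReal.ofReal_lt_top
  have h1 : ∫ ω, Real.exp (Z ω) ∂P ≤ Real.exp C := by
    rw [integral_eq_lintegral_of_nonneg_ae (ae_of_all _ fun ω => (Real.exp_pos _).le) hm]
    exact ENNReal.toReal_le_of_le_ofReal (Real.exp_pos _).le h
  have h2 : ∫ ω, (Z ω - C + 1) ∂P ≤ ∫ ω, Real.exp (-C) * Real.exp (Z ω) ∂P := by
    refine integral_mono ((hZ.sub (integrable_const C)).add (integrable_const 1))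
      (hint.const_mul _) fun ω => ?_
    have := Real.add_one_le_exp (Z ω - C)
    rwa [sub_eq_neg_add, Real.exp_add, ← sub_eq_neg_add] at this
  have h4 : ∫ ω, (Z ω - C + 1) ∂P = ∫ ω, Z ω ∂P - C + 1 := by
    have := integral_add (hZ.sub (integrable_const C)) (integrable_const (1 : ℝ))
    simp only [Pi.sub_apply] at this
    rw [this, integral_sub hZ (integrable_const C)]
    simp
  rw [h4, integral_const_mul] at h2
  have h3 : Real.exp (-C) * ∫ ω, Real.exp (Z ω) ∂P ≤ 1 := by
    calc _ ≤ Real.exp (-C) * Real.exp C := by gcongr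
      _ = 1 := by rw [← Real.exp_add]; simp
  linarith

end Gibbs

-- Finite entropy as a real integral.

section Entropy

variable {β : Type*} [MeasurableSpace β] [StandardBorelSpace β]

/-- The integrand is infinite at points of mass zero, so finiteness makes almost every point an
atom, and there the extended logarithm agrees with `Real.log`. -/
theorem entropy_finite_of_ne_top (m : Measure β) [IsProbabilityMeasure m]
    (h : ∫⁻ v, (-ENNReal.log (m {v})).toENNReal ∂m ≠ ∞) :
    (∀ᵐ v ∂m, m {v} ≠ 0) ∧ Integrable (fun v => Real.log (m {v}).toReal) m ∧
      ∫ v, Real.log (m {v}).toReal ∂m =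
        -(∫⁻ v, (-ENNReal.log (m {v})).toENNReal ∂m).toReal := by
  have hmeas := measurable_measure_singleton m
  have hpos : ∀ᵐ v ∂m, m {v} ≠ 0 := by
    have hlt := ae_lt_top (measurable_ereal_toENNReal.comp hmeas.ennreal_log.neg) h
    filter_upwards [hlt] with v hv h0
    simp [h0] at hv
  have heq : ∀ᵐ v ∂m, (-ENNReal.log (m {v})).toENNReal =
      ENNReal.ofReal (-Real.log (m {v}).toReal) := by
    filter_upwards [hpos] with v hv
    rw [ENNReal.log_pos_real hv (measure_ne_top _ _), ← EReal.coe_neg, EReal.toENNReal_of_ne_top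
      (EReal.coe_ne_top _), EReal.toReal_coe]
  have hle : ∀ v, 0 ≤ -Real.log (m {v}).toReal := fun v => by
    rw [neg_nonneg]
    exact Real.log_nonpos ENNReal.toReal_nonneg
      (ENNReal.toReal_le_of_le_ofReal zero_le_one (by simpa using prob_le_one))
  have hml : Measurable fun v => -Real.log (m {v}).toReal :=
    hmeas.ennreal_toReal.log.neg
  have hint : Integrable (fun v => -Real.log (m {v}).toReal) m := by
    refine ⟨hml.aestronglyMeasurable, ?_⟩
    rw [hasFiniteIntegral_iff_ofReal (ae_of_all _ hle), ← lintegral_congr_ae heq]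
    exact h.lt_top
  refine ⟨hpos, by simpa using hint.neg, ?_⟩
  rw [lintegral_congr_ae heq, ← integral_eq_lintegral_of_nonneg_ae (ae_of_all _ hle)
    hml.aestronglyMeasurable, integral_neg, neg_neg]

end Entropy

-- Change of measure to the decoupled law.

section ChangeOfMeasure

theorem integral_comp_of_measurePreserving {α β : Type*} [MeasurableSpace α]
    [MeasurableSpace β] {μ : Measure α} {ν : Measure β} {f : α → β} (hf : MeasurePreserving f μ ν)
    {g : β → ℝ} (hg : AEStronglyMeasurable g ν) : ∫ x, g (f x) ∂μ = ∫ y, g y ∂ν := by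
  rw [← hf.map_eq] at hg ⊢
  exact (integral_map hf.aemeasurable hg).symm

/-- Only an inequality, since the part of `μ` singular to `ν` is lost. -/
theorem lintegral_rnDeriv_mul_le {α : Type*} [MeasurableSpace α] (μ ν : Measure α)
    {f : α → ℝ≥0∞} (hf : Measurable f) :
    ∫⁻ x, f x * μ.rnDeriv ν x ∂ν ≤ ∫⁻ x, f x ∂μ := by
  calc ∫⁻ x, f x * μ.rnDeriv ν x ∂ν = ∫⁻ x, f x ∂(ν.withDensity (μ.rnDeriv ν)) := by
        rw [lintegral_withDensity_eq_lintegral_mul _ (Measure.measurable_rnDeriv _ _) hf]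
        simp [mul_comm]
    _ ≤ ∫⁻ x, f x ∂μ := lintegral_mono' (Measure.withDensity_rnDeriv_le _ _) le_rfl

variable {Ω α β γ : Type*} [MeasurableSpace Ω] [MeasurableSpace α] [MeasurableSpace β]
  [MeasurableSpace γ] {N : ℕ}

theorem lintegral_prod_pi_density (Q : Measure γ) [IsProbabilityMeasure Q]
    (τ : Measure (α × β)) [IsProbabilityMeasure τ] (hτ : τ ≪ τ.fst.prod τ.snd)
    {F : γ × (Fin N → α × β) → ℝ≥0∞} (hF : Measurable F) :
    ∫⁻ y, ∫⁻ x : γ × (Fin N → α), F (x.1, fun j => (x.2 j, y j)) *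
        ∏ j, τ.rnDeriv (τ.fst.prod τ.snd) (x.2 j, y j)
          ∂(Q.prod (Measure.pi fun _ => τ.fst)) ∂(Measure.pi fun _ => τ.snd) =
      ∫⁻ z, F z ∂(Q.prod (Measure.pi fun _ => τ)) := by
  set q := τ.rnDeriv (τ.fst.prod τ.snd) with hq
  have hqm : Measurable q := Measure.measurable_rnDeriv _ _
  have hpi : (Measure.pi fun _ : Fin N => τ) =
      (Measure.pi fun _ : Fin N => τ.fst.prod τ.snd).withDensity fun t => ∏ j, q (t j) := by
    have e : (τ.fst.prod τ.snd).withDensity q = τ := Measure.withDensity_rnDeriv_eq _ _ hτ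
    have : ∀ _ : Fin N, SigmaFinite ((τ.fst.prod τ.snd).withDensity q) := fun _ => by
      rw [e]; infer_instance
    rw [← pi_withDensity (fun _ : Fin N => τ.fst.prod τ.snd) fun _ => hqm]
    simp_rw [e]
  have hpres : MeasurePreserving
      (fun z : γ × (Fin N → α × β) => ((z.1, fun j => (z.2 j).1), fun j => (z.2 j).2))
      (Q.prod (Measure.pi fun _ => τ.fst.prod τ.snd))
      ((Q.prod (Measure.pi fun _ => τ.fst)).prod (Measure.pi fun _ => τ.snd)) := by
    have h1 := (MeasurePreserving.id Q).prod
      (measurePreserving_arrowProdEquivProdArrow α β (Fin N) (fun _ => τ.fst) (fun _ => τ.snd))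
    have h2 := (measurePreserving_prodAssoc Q (Measure.pi fun _ : Fin N => τ.fst)
      (Measure.pi fun _ : Fin N => τ.snd)).symm
    exact h2.comp h1
  have hG : Measurable fun x : (γ × (Fin N → α)) × (Fin N → β) =>
      F (x.1.1, fun j => (x.1.2 j, x.2 j)) * ∏ j, q (x.1.2 j, x.2 j) := by fun_prop
  rw [← lintegral_prod_symm' _ hG, ← hpres.lintegral_comp hG, lintegral_prod _ (by fun_prop),
    lintegral_prod _ (by fun_prop), hpi]
  refine lintegral_congr fun w => ?_
  rw [lintegral_withDensity_eq_lintegral_mul _ (by fun_prop) (by fun_prop)]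
  simp [mul_comm]

/-- A Donsker-Varadhan type bound for (V, T) in which the divergence of the full joint law is
replaced by the information between V and the first components, plus entropy minus information for
each sample point. -/
theorem integral_le_of_lintegral_exp_prod_le [StandardBorelSpace β] (P : Measure Ω) [IsProbabilityMeasure P]
    {V : Ω → γ} (hV : Measurable V) {T : Ω → Fin N → α × β} (hT : Measurable T)
    (τ : Measure (α × β)) [IsProbabilityMeasure τ] (hPT : P.map T = Measure.pi fun _ => τ)
    (hJ : klDiv τ (τ.fst.prod τ.snd) ≠ ∞)
    (hI : mutualInfo P V (fun ω j => (T ω j).1) ≠ ∞)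
    (hH : ∫⁻ v, (-ENNReal.log (τ.snd {v})).toENNReal ∂τ.snd ≠ ∞)
    {φ : γ × (Fin N → α × β) → ℝ} (hφ : Measurable φ)
    (hφi : Integrable (fun ω => φ (V ω, T ω)) P) {C : ℝ}
    (hC : ∫⁻ z, ENNReal.ofReal (Real.exp (φ z)) ∂((P.map V).prod (Measure.pi fun _ => τ)) ≤
      ENNReal.ofReal (Real.exp C)) :
    ∫ ω, φ (V ω, T ω) ∂P ≤ C + (mutualInfo P V (fun ω j => (T ω j).1)).toReal +
      N * ((∫⁻ v, (-ENNReal.log (τ.snd {v})).toENNReal ∂τ.snd).toReal -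
        (klDiv τ (τ.fst.prod τ.snd)).toReal) := by
  have hPV := Measure.isProbabilityMeasure_map (μ := P) hV.aemeasurable
  have hUm : Measurable fun ω j => (T ω j).1 := by fun_prop
  have hYm : Measurable fun ω j => (T ω j).2 := by fun_prop
  have hVU := hV.prodMk hUm
  set K := P.map fun ω => (V ω, fun j => (T ω j).1) with hK
  have hKp : IsProbabilityMeasure K := Measure.isProbabilityMeasure_map hVU.aemeasurable
  have hPU : (P.map fun ω j => (T ω j).1) = Measure.pi fun _ => τ.fst := by
    have := Measure.pi_map_pi (μ := fun _ : Fin N => τ) (f := fun _ => Prod.fst)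
      (fun _ => measurable_fst.aemeasurable)
    rw [← hPT, Measure.map_map (by fun_prop) hT] at this
    exact this
  have hPY : (P.map fun ω j => (T ω j).2) = Measure.pi fun _ => τ.snd := by
    have := Measure.pi_map_pi (μ := fun _ : Fin N => τ) (f := fun _ => Prod.snd)
      (fun _ => measurable_snd.aemeasurable)
    rw [← hPT, Measure.map_map (by fun_prop) hT] at this
    exact this
  have hPTj : ∀ j, MeasurePreserving (fun ω => T ω j) P τ := fun j =>
    (measurePreserving_eval (fun _ => τ) j).comp ⟨hT, hPT⟩
  set R := (P.map V).prod (Measure.pi fun _ : Fin N => τ.fst) with hR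
  have hI' : mutualInfo P V (fun ω j => (T ω j).1) = klDiv K R := by
    rw [mutualInfo, hPU]
  rw [hI'] at hI ⊢
  obtain ⟨hKR, hKi⟩ := klDiv_ne_top_iff.mp hI
  obtain ⟨hτ, hτi⟩ := klDiv_ne_top_iff.mp hJ
  obtain ⟨hp0, hpi, hpint⟩ := entropy_finite_of_ne_top τ.snd hH
  set q := τ.rnDeriv (τ.fst.prod τ.snd) with hq
  have hqm : Measurable q := Measure.measurable_rnDeriv _ _
  have hKpres : MeasurePreserving (fun ω => (V ω, fun j => (T ω j).1)) P K := ⟨hVU, rfl⟩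
  have hsnd : ∀ j, MeasurePreserving (fun ω => (T ω j).2) P τ.snd := fun j =>
    (⟨measurable_snd, rfl⟩ : MeasurePreserving Prod.snd τ τ.snd).comp (hPTj j)
  -- The three corrections to φ have means minus I(V; first components), -N H and N J. It therefore
  -- suffices to bound E[exp Z] by exp C.
  set Z : Ω → ℝ := fun ω => φ (V ω, T ω) - llr K R (V ω, fun j => (T ω j).1) +
    ∑ j, Real.log (τ.snd {(T ω j).2}).toReal +
    ∑ j, llr τ (τ.fst.prod τ.snd) (T ω j) with hZ
  have i1 : Integrable (fun ω => llr K R (V ω, fun j => (T ω j).1)) P :=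
    hKpres.integrable_comp_of_integrable hKi
  have i2 : ∀ j, Integrable (fun ω => Real.log (τ.snd {(T ω j).2}).toReal) P := fun j =>
    (hsnd j).integrable_comp_of_integrable hpi
  have i3 : ∀ j, Integrable (fun ω => llr τ (τ.fst.prod τ.snd) (T ω j)) P := fun j =>
    (hPTj j).integrable_comp_of_integrable hτi
  have i12 := (hφi.sub i1).add (integrable_finsetSum Finset.univ fun j _ => i2 j)
  have i3s := integrable_finsetSum Finset.univ fun j _ => i3 j
  have hZi : Integrable Z P := i12.add i3s
  have hZint : ∫ ω, Z ω ∂P = ∫ ω, φ (V ω, T ω) ∂P - (klDiv K R).toReal -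
      N * (∫⁻ v, (-ENNReal.log (τ.snd {v})).toENNReal ∂τ.snd).toReal +
      N * (klDiv τ (τ.fst.prod τ.snd)).toReal := by
    have e1 : ∫ ω, llr K R (V ω, fun j => (T ω j).1) ∂P = (klDiv K R).toReal := by
      rw [toReal_klDiv_of_measure_eq hKR (by simp)]
      exact integral_comp_of_measurePreserving hKpres hKi.1
    have e2 : ∀ j, ∫ ω, Real.log (τ.snd {(T ω j).2}).toReal ∂P =
        -(∫⁻ v, (-ENNReal.log (τ.snd {v})).toENNReal ∂τ.snd).toReal := fun j => by
      rw [← hpint]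
      exact integral_comp_of_measurePreserving (hsnd j) hpi.1
    have e3 : ∀ j, ∫ ω, llr τ (τ.fst.prod τ.snd) (T ω j) ∂P =
        (klDiv τ (τ.fst.prod τ.snd)).toReal := fun j => by
      rw [toReal_klDiv_of_measure_eq hτ (by simp)]
      exact integral_comp_of_measurePreserving (hPTj j) hτi.1
    calc ∫ ω, Z ω ∂P = _ := integral_add i12 i3s
      _ = _ := by
        rw [integral_finsetSum _ fun j _ => i3 j]
        have := integral_add (hφi.sub i1) (integrable_finsetSum Finset.univ fun j _ => i2 j)
        simp only [Pi.sub_apply] at this ⊢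
        rw [this, integral_sub hφi i1, integral_finsetSum _ fun j _ => i2 j, e1]
        simp only [e2, e3, Finset.sum_const, Finset.card_univ, Fintype.card_fin, nsmul_eq_mul]
        ring
  have hexp : ∫⁻ ω, ENNReal.ofReal (Real.exp (Z ω)) ∂P ≤ ENNReal.ofReal (Real.exp C) := by
    set G : (γ × (Fin N → α)) × (Fin N → β) → ℝ≥0∞ := fun z =>
      ENNReal.ofReal (Real.exp (φ (z.1.1, fun j => (z.1.2 j, z.2 j)))) *
        (∏ j, q (z.1.2 j, z.2 j)) * R.rnDeriv K z.1 with hG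
    have hGm : Measurable G := by fun_prop
    set ρ := P.map fun ω => ((V ω, fun j => (T ω j).1), fun j => (T ω j).2) with hρ
    have hρm : Measurable fun ω => ((V ω, fun j => (T ω j).1), fun j => (T ω j).2) :=
      hVU.prodMk hYm
    have hρp : IsProbabilityMeasure ρ := Measure.isProbabilityMeasure_map hρm.aemeasurable
    have hρ1 : ρ.fst = K := by
      rw [Measure.fst, hρ, Measure.map_map measurable_fst hρm]; rfl
    have hρ2 : ρ.snd = Measure.pi fun _ => τ.snd := by
      rw [Measure.snd, hρ, Measure.map_map measurable_snd hρm, ← hPY]; rfl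
    -- The factor exp(-llr K R) is dR/dK, and the label masses multiply to the mass of the whole
    -- label vector. This is the weight required by `lintegral_mul_measure_singleton_le`.
    have hae : ∀ᵐ ω ∂P, ENNReal.ofReal (Real.exp (Z ω)) =
        G ((V ω, fun j => (T ω j).1), fun j => (T ω j).2) *
          (Measure.pi fun _ : Fin N => τ.snd) {fun j => (T ω j).2} := by
      have a1 : ∀ᵐ ω ∂P, Real.exp (-llr K R (V ω, fun j => (T ω j).1)) =
          (R.rnDeriv K (V ω, fun j => (T ω j).1)).toReal :=
        hKpres.quasiMeasurePreserving.ae (exp_neg_llr hKR)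
      have a1' : ∀ᵐ ω ∂P, R.rnDeriv K (V ω, fun j => (T ω j).1) < ∞ :=
        hKpres.quasiMeasurePreserving.ae (Measure.rnDeriv_lt_top R K)
      have a2 : ∀ᵐ ω ∂P, ∀ j, τ.snd {(T ω j).2} ≠ 0 :=
        ae_all_iff.mpr fun j => (hsnd j).quasiMeasurePreserving.ae hp0
      have a3 : ∀ᵐ ω ∂P, ∀ j, 0 < q (T ω j) ∧ q (T ω j) < ∞ :=
        ae_all_iff.mpr fun j => (hPTj j).quasiMeasurePreserving.ae
          ((Measure.rnDeriv_pos hτ).and (hτ.ae_le (Measure.rnDeriv_lt_top _ _)))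
      filter_upwards [a1, a1', a2, a3] with ω h1 h1' h2 h3
      have hsing : (Measure.pi fun _ : Fin N => τ.snd) {fun j => (T ω j).2} =
          ∏ j, τ.snd {(T ω j).2} := by
        rw [← Set.univ_pi_singleton, Measure.pi_pi]
      rw [hsing, hZ, hG]
      simp only
      rw [sub_eq_add_neg, Real.exp_add, Real.exp_add, Real.exp_add, Real.exp_sum, Real.exp_sum, h1,
        ENNReal.ofReal_mul (by positivity), ENNReal.ofReal_mul (by positivity),
        ENNReal.ofReal_mul (by positivity), ENNReal.ofReal_toReal h1'.ne,
        ENNReal.ofReal_prod_of_nonneg fun _ _ => (Real.exp_pos _).le,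
        ENNReal.ofReal_prod_of_nonneg fun _ _ => (Real.exp_pos _).le]
      have b2 : ∀ j, ENNReal.ofReal (Real.exp (Real.log (τ.snd {(T ω j).2}).toReal)) =
          τ.snd {(T ω j).2} := fun j => by
        rw [Real.exp_log (ENNReal.toReal_pos (h2 j) (measure_ne_top _ _)),
          ENNReal.ofReal_toReal (measure_ne_top _ _)]
      have b3 : ∀ j, ENNReal.ofReal (Real.exp (llr τ (τ.fst.prod τ.snd) (T ω j))) =
          q (T ω j) := fun j => by
        rw [llr, Real.exp_log (ENNReal.toReal_pos (h3 j).1.ne' (h3 j).2.ne),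
          ENNReal.ofReal_toReal (h3 j).2.ne]
      simp only [b2, b3, Prod.mk.eta]
      ring
    calc ∫⁻ ω, ENNReal.ofReal (Real.exp (Z ω)) ∂P
        = ∫⁻ z, G z * ρ.snd {z.2} ∂ρ := by
          rw [lintegral_congr_ae hae, hρ2, hρ, lintegral_map _ hρm]
          exact hGm.mul ((measurable_measure_singleton _).comp measurable_snd)
      _ ≤ ∫⁻ y, ∫⁻ x, G (x, y) ∂ρ.fst ∂ρ.snd := lintegral_mul_measure_singleton_le ρ hGm
      _ ≤ ∫⁻ y, ∫⁻ x : γ × (Fin N → α),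
            ENNReal.ofReal (Real.exp (φ (x.1, fun j => (x.2 j, y j)))) *
            (∏ j, q (x.2 j, y j)) ∂(R) ∂(Measure.pi fun _ => τ.snd) := by
          rw [hρ1, hρ2]
          refine lintegral_mono fun y => ?_
          exact lintegral_rnDeriv_mul_le R K (by fun_prop)
      _ = _ := lintegral_prod_pi_density (P.map V) τ hτ
            (F := fun z => ENNReal.ofReal (Real.exp (φ z))) (by fun_prop)
      _ ≤ _ := hC
  have := integral_le_of_lintegral_exp_le P hZi hexp
  rw [hZint] at this
  linarith

end ChangeOfMeasure

-- Hoeffding's lemma and optimization over t.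

section Hoeffding

theorem lintegral_exp_sum_centered_le {D : Type*} [MeasurableSpace D] {N : ℕ} (τ : Measure D)
    [IsProbabilityMeasure τ] {f : D → ℝ} (hf : Measurable f) {a b : ℝ}
    (hab : ∀ x, f x ∈ Set.Icc a b) (t : ℝ) :
    ∫⁻ x : Fin N → D, ENNReal.ofReal (Real.exp (t * ∑ j, (∫ y, f y ∂τ - f (x j))))
        ∂(Measure.pi fun _ => τ) ≤
      ENNReal.ofReal (Real.exp (N * (((b - a) / 2) ^ 2 * t ^ 2 / 2))) := by
  have hsub := hasSubgaussianMGF_of_mem_Icc (μ := τ) hf.aemeasurable (ae_of_all _ hab)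
  have h1 : ∫⁻ y, ENNReal.ofReal (Real.exp (t * (∫ z, f z ∂τ - f y))) ∂τ ≤
      ENNReal.ofReal (Real.exp (((b - a) / 2) ^ 2 * t ^ 2 / 2)) := by
    have e : ∀ y, t * (∫ z, f z ∂τ - f y) = -t * (f y - ∫ z, f z ∂τ) := fun y => by ring
    simp_rw [e]
    rw [← ofReal_integral_eq_lintegral_ofReal (hsub.integrable_exp_mul (-t))
      (ae_of_all _ fun _ => (Real.exp_pos _).le)]
    refine ENNReal.ofReal_le_ofReal ((hsub.mgf_le (-t)).trans_eq ?_)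
    simp [div_pow]
  calc ∫⁻ x : Fin N → D, ENNReal.ofReal (Real.exp (t * ∑ j, (∫ y, f y ∂τ - f (x j))))
        ∂(Measure.pi fun _ => τ)
      = ∫⁻ x : Fin N → D, ∏ j, ENNReal.ofReal (Real.exp (t * (∫ y, f y ∂τ - f (x j))))
        ∂(Measure.pi fun _ => τ) := by
        refine lintegral_congr fun x => ?_
        rw [Finset.mul_sum, Real.exp_sum,
          ENNReal.ofReal_prod_of_nonneg fun _ _ => (Real.exp_pos _).le]
    _ = ∏ _j : Fin N, ∫⁻ y, ENNReal.ofReal (Real.exp (t * (∫ z, f z ∂τ - f y))) ∂τ :=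
        lintegral_prod_pi (fun _ => τ)
          (f := fun _ y => ENNReal.ofReal (Real.exp (t * (∫ z, f z ∂τ - f y))))
          fun _ => by fun_prop
    _ ≤ ∏ _j : Fin N, ENNReal.ofReal (Real.exp (((b - a) / 2) ^ 2 * t ^ 2 / 2)) :=
        Finset.prod_le_prod' fun _ _ => h1
    _ = _ := by
        rw [Finset.prod_const, Finset.card_univ, Fintype.card_fin,
          ← ENNReal.ofReal_pow (Real.exp_pos _).le, ← Real.exp_nat_mul]

theorem abs_le_sqrt_of_forall_mul_le {G R σ : ℝ}
    (h : ∀ t : ℝ, t * G ≤ σ ^ 2 * t ^ 2 / 2 + R) :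
    |G| ≤ Real.sqrt (2 * σ ^ 2) * Real.sqrt R := by
  rw [← Real.sqrt_mul (by positivity)]
  refine Real.abs_le_sqrt ?_
  by_cases hσ : σ = 0
  · subst hσ
    by_contra hG
    have hG0 : G ≠ 0 := by
      rintro rfl
      simp at hG
    -- For σ = 0 the bound is linear in t, and this choice would give R + 1 ≤ R.
    have := h ((R + 1) / G)
    rw [div_mul_cancel₀ _ hG0] at this
    norm_num at this
  · have hσ2 : 0 < σ ^ 2 := by positivity
    -- The maximizer of t G - σ²t²/2.
    have := h (G / σ ^ 2)
    have e1 : G / σ ^ 2 * G = G ^ 2 / σ ^ 2 := by ring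
    have e2 : σ ^ 2 * (G / σ ^ 2) ^ 2 / 2 = G ^ 2 / σ ^ 2 / 2 := by field_simp
    rw [e1, e2] at this
    have h3 : G ^ 2 / σ ^ 2 ≤ 2 * R := by linarith
    rw [div_le_iff₀ hσ2] at h3
    linarith

end Hoeffding

-- The bound for the learning problem.

section Learning

variable {M N : ℕ} {𝒳 𝒵 𝒴 𝒲 : Type*} [MeasurableSpace 𝒳] [MeasurableSpace 𝒵] [MeasurableSpace 𝒴]
  [MeasurableSpace 𝒲]

theorem measurable_hHat {g : 𝒵 → 𝒴} (hg : Measurable g) {h : Fin M → 𝒳 → 𝒵}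
    (hh : ∀ m, Measurable (h m)) : Measurable (hHat g h) :=
  measurable_pi_lambda _ fun i => hg.comp (hh i)

theorem measurable_feat {g : 𝒵 → 𝒴} (hg : Measurable g) {h : Fin M → 𝒳 → 𝒵}
    (hh : ∀ m, Measurable (h m)) : Measurable (feat (Y := 𝒴) g h) :=
  ((measurable_hHat hg hh).comp measurable_fst).prodMk measurable_snd

theorem popRisk_eq (hN : 0 < N) (μ : Measure (𝒳 × 𝒴)) [IsProbabilityMeasure μ]
    {g : 𝒵 → 𝒴} (hg : Measurable g) {h : Fin M → 𝒳 → 𝒵} (hh : ∀ m, Measurable (h m))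
    {ℓ : (Fin M → 𝒴) × 𝒴 → 𝒲 → ℝ} (hℓ : Measurable (Function.uncurry ℓ))
    {a b : ℝ} (hab : ∀ u w, ℓ u w ∈ Set.Icc a b) (w : 𝒲) :
    popRisk N μ g h ℓ w = ∫ u, ℓ u w ∂(μ.map (feat g h)) := by
  have hf := measurable_feat hg hh
  have hw : Measurable fun u => ℓ u w := hℓ.comp measurable_prodMk_right
  have hj : ∀ j : Fin N, MeasurePreserving (fun s : Fin N → 𝒳 × 𝒴 => feat g h (s j))
      (Measure.pi fun _ => μ) (μ.map (feat g h)) := fun j =>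
    (⟨hf, rfl⟩ : MeasurePreserving (feat g h) μ _).comp (measurePreserving_eval (fun _ => μ) j)
  have hi : ∀ j : Fin N, Integrable (fun s : Fin N → 𝒳 × 𝒴 => ℓ (feat g h (s j)) w)
      (Measure.pi fun _ => μ) := fun j =>
    Integrable.of_mem_Icc a b (hw.comp (hj j).measurable).aemeasurable
      (ae_of_all _ fun s => hab _ _)
  have hN' : (N : ℝ) ≠ 0 := by positivity
  simp only [popRisk, empRisk, sampleLaw]
  rw [integral_const_mul, integral_finsetSum _ fun j _ => hi j]
  simp_rw [fun j => integral_comp_of_measurePreserving (hj j)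
    hw.aestronglyMeasurable]
  simp [hN']

/-- Under the product law, W is independent of the sample, so Hoeffding's lemma applies for each
fixed w. -/
theorem mul_gap_le [StandardBorelSpace 𝒴] (hN : 0 < N) (μ : Measure (𝒳 × 𝒴))
    [IsProbabilityMeasure μ] (κ : Kernel (Fin N → 𝒳 × 𝒴) 𝒲) [IsMarkovKernel κ]
    {g : 𝒵 → 𝒴} (hg : Measurable g) {h : Fin M → 𝒳 → 𝒵} (hh : ∀ m, Measurable (h m))
    {ℓ : (Fin M → 𝒴) × 𝒴 → 𝒲 → ℝ} (hℓ : Measurable (Function.uncurry ℓ))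
    {a b : ℝ} (hab : ∀ u w, ℓ u w ∈ Set.Icc a b)
    (hJ : mutualInfo μ (fun d => hHat g h d.1) (fun d => d.2) ≠ ∞)
    (hH : entropy μ (fun d => d.2) ≠ ∞) (hI : I₄ μ κ g h ≠ ∞) (t : ℝ) :
    t * ∫ p, (popRisk N μ g h ℓ p.2 - empRisk g h ℓ p.1 p.2) ∂(jointLaw μ κ) ≤
      ((b - a) / 2) ^ 2 * t ^ 2 / 2 + ((entropy μ (fun d => d.2)).toReal -
        (mutualInfo μ (fun d => hHat g h d.1) (fun d => d.2)).toReal + (I₄ μ κ g h).toReal) := by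
  have hf := measurable_feat hg hh
  have hN' : (0 : ℝ) < N := by positivity
  set τ := μ.map (feat g h) with hτ
  have hτp : IsProbabilityMeasure τ := Measure.isProbabilityMeasure_map hf.aemeasurable
  have hτ1 : τ.fst = μ.map fun d => hHat g h d.1 := by
    rw [Measure.fst, hτ, Measure.map_map measurable_fst hf]; rfl
  have hτ2 : τ.snd = μ.map fun d => d.2 := by
    rw [Measure.snd, hτ, Measure.map_map measurable_snd hf]; rfl
  have eJ : mutualInfo μ (fun d => hHat g h d.1) (fun d => d.2) =
      klDiv τ (τ.fst.prod τ.snd) := by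
    rw [hτ1, hτ2]; rfl
  have eH : entropy μ (fun d => d.2) = ∫⁻ v, (-ENNReal.log (τ.snd {v})).toENNReal ∂τ.snd := by
    rw [hτ2]; rfl
  set P := jointLaw μ κ with hP
  have hSp : IsProbabilityMeasure (sampleLaw N μ) := by unfold sampleLaw; infer_instance
  have hPp : IsProbabilityMeasure P := by rw [hP, jointLaw]; infer_instance
  set T : (Fin N → 𝒳 × 𝒴) × 𝒲 → Fin N → (Fin M → 𝒴) × 𝒴 := fun p j => feat g h (p.1 j) with hT
  have hTm : Measurable T := by fun_prop
  have hPT : P.map T = Measure.pi fun _ => τ := by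
    have h1 := Measure.pi_map_pi (μ := fun _ : Fin N => μ) (f := fun _ => feat g h)
      (fun _ => hf.aemeasurable)
    have h2 : P.map Prod.fst = Measure.pi fun _ => μ := Measure.fst_compProd _ _
    rw [← h2, Measure.map_map (by fun_prop) measurable_fst] at h1
    exact h1
  have eI : I₄ μ κ g h = mutualInfo P (fun p => p.2) (fun p j => (T p j).1) / (N : ℝ≥0∞) := rfl
  have hI' : mutualInfo P (fun p => p.2) (fun p j => (T p j).1) ≠ ∞ := fun h0 => by
    rw [eI, h0, ENNReal.top_div_of_ne_top (ENNReal.natCast_ne_top N)] at hI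
    exact hI rfl
  set m : 𝒲 → ℝ := fun w => ∫ u, ℓ u w ∂τ with hm
  have hmm : Measurable m := by
    have : StronglyMeasurable (Function.uncurry fun (w : 𝒲) u => ℓ u w) :=
      (hℓ.comp measurable_swap).stronglyMeasurable
    exact this.integral_prod_right.measurable
  have hℓ' : ∀ j : Fin N, Measurable fun z : 𝒲 × (Fin N → (Fin M → 𝒴) × 𝒴) => ℓ (z.2 j) z.1 :=
    fun j => hℓ.comp (g := Function.uncurry ℓ)
      (f := fun z : 𝒲 × (Fin N → (Fin M → 𝒴) × 𝒴) => (z.2 j, z.1)) (by fun_prop)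
  -- A sum rather than an average: every term of the resulting bound then carries a factor N, once
  -- the information of W is written as N I₄, and N is cancelled at the end.
  set φ : 𝒲 × (Fin N → (Fin M → 𝒴) × 𝒴) → ℝ := fun z => t * ∑ j, (m z.1 - ℓ (z.2 j) z.1) with hφ
  have hφm : Measurable φ := by fun_prop
  have hmab : ∀ w, m w ∈ Set.Icc a b := fun w => by
    have hw : Integrable (fun u => ℓ u w) τ := Integrable.of_mem_Icc a b
      (hℓ.comp measurable_prodMk_right).aemeasurable (ae_of_all _ fun u => hab u w)
    constructor
    · simpa using integral_mono (integrable_const a) hw fun u => (hab u w).1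
    · simpa using integral_mono hw (integrable_const b) fun u => (hab u w).2
  have hφi : Integrable (fun p => φ (p.2, T p)) P := by
    refine Integrable.const_mul (integrable_finsetSum _ fun j _ => Integrable.sub ?_ ?_) t
    · exact Integrable.of_mem_Icc a b (by fun_prop) (ae_of_all _ fun p => hmab _)
    · exact Integrable.of_mem_Icc a b
        ((hℓ' j).comp (measurable_snd.prodMk hTm)).aemeasurable (ae_of_all _ fun p => hab _ _)
  have hC : ∫⁻ z, ENNReal.ofReal (Real.exp (φ z))
      ∂((P.map fun p => p.2).prod (Measure.pi fun _ => τ)) ≤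
      ENNReal.ofReal (Real.exp (N * (((b - a) / 2) ^ 2 * t ^ 2 / 2))) := by
    have := Measure.isProbabilityMeasure_map (μ := P) measurable_snd.aemeasurable
    rw [lintegral_prod _ (by fun_prop)]
    calc _ ≤ ∫⁻ _, ENNReal.ofReal (Real.exp (N * (((b - a) / 2) ^ 2 * t ^ 2 / 2)))
            ∂(P.map fun p => p.2) :=
          lintegral_mono fun w => lintegral_exp_sum_centered_le τ
            (hℓ.comp measurable_prodMk_right) (fun u => hab u w) t
      _ = _ := by simp
  rw [eJ] at hJ
  rw [eH] at hH
  have key := integral_le_of_lintegral_exp_prod_le P measurable_snd hTm τ hPT hJ hI' hH hφm hφi hC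
  have hgap : ∀ p : (Fin N → 𝒳 × 𝒴) × 𝒲, φ (p.2, T p) =
      (N * t) * (popRisk N μ g h ℓ p.2 - empRisk g h ℓ p.1 p.2) := fun p => by
    rw [popRisk_eq hN μ hg hh hℓ hab, empRisk]
    simp only [hφ, hT, Finset.sum_sub_distrib, Finset.sum_const, Finset.card_univ,
      Fintype.card_fin, nsmul_eq_mul]
    field_simp
    rfl
  simp_rw [hgap] at key
  rw [integral_const_mul, ← eJ, ← eH] at key
  have hIr : (mutualInfo P (fun p => p.2) (fun p j => (T p j).1)).toReal =
      N * (I₄ μ κ g h).toReal := by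
    rw [eI, ENNReal.toReal_div, ENNReal.toReal_natCast]
    field_simp
  rw [hIr] at key
  refine le_of_mul_le_mul_left ?_ hN'
  linarith

end Learning

/-- By the chain rule, finite I₂ and I₃ force I₁ and J to be finite, so the subtraction takes place
in the reals. Entropy and I₄ may still be infinite and stay in `ℝ≥0∞`. -/
theorem radicand_eq {M N : ℕ} {𝒳 𝒵 𝒴 𝒲 : Type*} [MeasurableSpace 𝒳] [MeasurableSpace 𝒵]
    [MeasurableSpace 𝒴] [MeasurableSpace 𝒲] [StandardBorelSpace 𝒴] [Nonempty 𝒴]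
    (μ : Measure (𝒳 × 𝒴)) [IsProbabilityMeasure μ] (κ : Kernel (Fin N → 𝒳 × 𝒴) 𝒲)
    {g : 𝒵 → 𝒴} (hg : Measurable g) {h : Fin M → 𝒳 → 𝒵} (hh : ∀ m, Measurable (h m))
    (hI₂ : I₂ μ g h ≠ ∞) (hI₃ : I₃ μ g h ≠ ∞) :
    mutualInfo μ (fun d => hHat g h d.1) (fun d => d.2) ≠ ∞ ∧
      radicand μ κ g h =
        ((-(mutualInfo μ (fun d => hHat g h d.1) (fun d => d.2)).toReal : ℝ) : EReal) +
          ((entropy μ (fun d => d.2) + I₄ μ κ g h : ℝ≥0∞) : EReal) := by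
  have hchain : I₁ μ g h + mutualInfo μ (fun d => hHat g h d.1) (fun d => d.2) =
      I₂ μ g h + I₃ μ g h :=
    multiInfo_add_mutualInfo μ ((measurable_hHat hg hh).comp measurable_fst) measurable_snd
  have hfin : I₁ μ g h + mutualInfo μ (fun d => hHat g h d.1) (fun d => d.2) ≠ ∞ := by
    rw [hchain]
    exact ENNReal.add_ne_top.mpr ⟨hI₂, hI₃⟩
  obtain ⟨hI₁, hJ⟩ := ENNReal.add_ne_top.mp hfin
  refine ⟨hJ, ?_⟩
  have hreal := congrArg ENNReal.toReal hchain
  rw [ENNReal.toReal_add hI₁ hJ, ENNReal.toReal_add hI₂ hI₃] at hreal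
  have hc : ∀ x : ℝ≥0∞, x ≠ ∞ → (x : EReal) = ((x.toReal : ℝ) : EReal) := fun x hx =>
    (EReal.coe_ennreal_toReal hx).symm
  rw [radicand, hc _ hI₁, hc _ hI₂, hc _ hI₃, add_assoc, ← EReal.coe_ennreal_add,
    ← EReal.coe_sub, ← EReal.coe_sub]
  congr 2
  linarith

end FusionBound

theorem mainTheorem2 {M N : ℕ} (hN : 0 < N)
    {𝒳 : Fin M → Type*} [∀ m, MeasurableSpace (𝒳 m)]
    {𝒵 : Type*} [MeasurableSpace 𝒵]
    {𝒴 : Type*} [MeasurableSpace 𝒴] [StandardBorelSpace 𝒴] [Nonempty 𝒴]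
    {𝒲 : Type*} [MeasurableSpace 𝒲]
    (μ : Measure ((∀ m, 𝒳 m) × 𝒴)) [IsProbabilityMeasure μ]
    (κ : Kernel (Fin N → (∀ m, 𝒳 m) × 𝒴) 𝒲) [IsMarkovKernel κ]
    (h : Fin M → (∀ m, 𝒳 m) → 𝒵) (hh : ∀ m, Measurable (h m))
    (g : 𝒵 → 𝒴) (hg : Measurable g)
    (ℓ : (Fin M → 𝒴) × 𝒴 → 𝒲 → ℝ) (hℓ : Measurable (Function.uncurry ℓ))
    (a b : ℝ) (hab : ∀ u w, ℓ u w ∈ Set.Icc a b)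
    (hI₂ : FusionBound.I₂ μ g h ≠ ∞) (hI₃ : FusionBound.I₃ μ g h ≠ ∞)
    (σ : ℝ) (hσ : σ = (b - a) / 2) :
    0 ≤ FusionBound.radicand μ κ g h ∧
    ENNReal.ofReal (FusionBound.genGap μ κ g h ℓ) ≤
      ENNReal.ofReal (Real.sqrt (2 * σ ^ 2)) *
        (FusionBound.radicand μ κ g h).toENNReal ^ (1 / 2 : ℝ) := by
  obtain ⟨hJ, hrad⟩ := FusionBound.radicand_eq μ κ hg hh hI₂ hI₃
  rw [hrad]
  by_cases hfin : FusionBound.entropy μ (fun d => d.2) + FusionBound.I₄ μ κ g h = ∞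
  · rw [hfin, EReal.coe_ennreal_top, EReal.coe_add_top]
    refine ⟨le_top, ?_⟩
    -- With an infinite radicand the right side is 0 · ∞ = 0 when σ = 0. The loss is then constant
    -- and the gap vanishes.
    by_cases hσ0 : σ = 0
    · have hba : b = a := by linarith
      have hℓa : ℓ = fun _ _ => a := by
        funext u w
        have := hab u w
        rw [hba] at this
        exact le_antisymm this.2 this.1
      have hS : IsProbabilityMeasure (FusionBound.sampleLaw N μ) := by
        unfold FusionBound.sampleLaw; infer_instance
      simp [FusionBound.genGap, FusionBound.popRisk, FusionBound.empRisk, hℓa]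
    · have hpos : ENNReal.ofReal (Real.sqrt (2 * σ ^ 2)) ≠ 0 := by
        have : 0 < Real.sqrt (2 * σ ^ 2) := Real.sqrt_pos.mpr (by positivity)
        simpa using this
      rw [EReal.toENNReal_top, ENNReal.top_rpow_of_pos (by norm_num), ENNReal.mul_top hpos]
      exact le_top
  · obtain ⟨hH, hI⟩ := ENNReal.add_ne_top.mp hfin
    set R : ℝ := (FusionBound.entropy μ (fun d => d.2)).toReal -
      (FusionBound.mutualInfo μ (fun d => FusionBound.hHat g h d.1) (fun d => d.2)).toReal +
      (FusionBound.I₄ μ κ g h).toReal with hR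
    have hkey := FusionBound.mul_gap_le hN μ κ hg hh hℓ hab hJ hH hI
    rw [← hσ, ← hR] at hkey
    -- Nonnegativity of the radicand is the case t = 0.
    have hR0 : 0 ≤ R := by simpa using hkey 0
    have hcoe : ((-(FusionBound.mutualInfo μ (fun d => FusionBound.hHat g h d.1)
        (fun d => d.2)).toReal : ℝ) : EReal) + ((FusionBound.entropy μ (fun d => d.2) +
          FusionBound.I₄ μ κ g h : ℝ≥0∞) : EReal) = (R : EReal) := by
      rw [← ENNReal.ofReal_toReal hfin, EReal.coe_ennreal_ofReal,
        max_eq_left ENNReal.toReal_nonneg, ← EReal.coe_add, ENNReal.toReal_add hH hI]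
      congr 1
      rw [hR]
      ring
    rw [hcoe]
    refine ⟨EReal.coe_nonneg.mpr hR0, ?_⟩
    rw [EReal.toENNReal_of_ne_top (EReal.coe_ne_top R), EReal.toReal_coe,
      ENNReal.ofReal_rpow_of_nonneg hR0 (by norm_num), ← Real.sqrt_eq_rpow,
      ← ENNReal.ofReal_mul (Real.sqrt_nonneg _)]
    exact ENNReal.ofReal_le_ofReal (FusionBound.abs_le_sqrt_of_forall_mul_le hkey)
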